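/- A polynomial $p(z)=p_Nz^N+\cdots+p_0$ with real coefficients is called Hurwitz stable if all its complex zeros lie in the open left half-plane $\{z\in\mathbb{C}:\operatorname{Re} z<0\}$. For a positive integer $N$, let $p_{\max}(N)$ denote the minimum, over all Hurwitz stable polynomials $p(z)=p_Nz^N+\cdots+p_0$ of degree $N$ whose coefficients $p_0,\dots,p_N$ are all positive integers, of the largest coefficient $\max_{0\le j\le N}p_j$. Theorem. If $N$ is a positive integer divisible by $20$, then \[\frac{1.41^N}{N} < p_{\max}(N) < 1.56^N\left(\frac{0.68}{\sqrt{N}}+0.97^N\right).\] -/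

import Mathlib

open Polynomial

/-- A polynomial with real coefficients is Hurwitz stable if all its complex zeros are located in
the open left half-plane. -/
def IsHurwitzStable (p : ℝ[X]) : Prop :=
  ∀ z : ℂ, aeval z p = 0 → z.re < 0

/-- The Hurwitz stable polynomials of degree `N` all of whose coefficients `p_0, …, p_N` are
positive integers. -/
def positiveHurwitz (N : ℕ) : Set ℤ[X] :=
  {p | p.natDegree = N ∧ (∀ i ≤ N, 0 < p.coeff i) ∧
    IsHurwitzStable (p.map (Int.castRingHom ℝ))}

/-- The largest of the coefficients `p_0, …, p_N` of a polynomial of degree `N`. -/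
def maxCoeff (p : ℤ[X]) : ℤ :=
  (Finset.range (p.natDegree + 1)).sup' Finset.nonempty_range_add_one p.coeff

/-- The minimum of the largest coefficients of the Hurwitz stable polynomials of degree `N` with
positive integer coefficients. (It is attained: see `isLeast_pMax`.) -/
noncomputable def pMax (N : ℕ) : ℤ :=
  sInf (maxCoeff '' positiveHurwitz N)

theorem X_add_one_pow_mem_positiveHurwitz (N : ℕ) :
    ((X + 1) ^ N : ℤ[X]) ∈ positiveHurwitz N := by
  refine ⟨?_, ?_, ?_⟩
  · have h : (X + 1 : ℤ[X]).natDegree = 1 := by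
      simpa using natDegree_X_add_C (1 : ℤ)
    rw [natDegree_pow, h, mul_one]
  · intro i hi
    rw [coeff_X_add_one_pow]
    exact_mod_cast Nat.choose_pos hi
  · intro z hz
    have h : (z + 1) ^ N = 0 := by simpa using hz
    have h1 : z = -1 := eq_neg_of_add_eq_zero_left (by by_contra h0; exact pow_ne_zero N h0 h)
    simp [h1]

/-- `pMax N` is a genuine minimum. -/
theorem isLeast_pMax (N : ℕ) : IsLeast (maxCoeff '' positiveHurwitz N) (pMax N) := by
  have hb : BddBelow (maxCoeff '' positiveHurwitz N) := by
    refine ⟨0, ?_⟩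
    rintro _ ⟨p, ⟨-, hpos, -⟩, rfl⟩
    exact (hpos 0 (Nat.zero_le N)).le.trans
      (Finset.le_sup' p.coeff (Finset.mem_range.2 (Nat.succ_pos _)))
  exact ⟨Int.csInf_mem ⟨_, _, X_add_one_pow_mem_positiveHurwitz N, rfl⟩ hb,
    fun _ hm => csInf_le hb hm⟩

/-! Lower bound. For a Hurwitz stable integer polynomial p of degree n, with leading coefficient a
and zeros z_i, the resultant of p(x) and p(-x) is a nonzero integer, so |a|^(2n) ∏|z_i + z_j| ≥ 1
over all ordered pairs. The Cayley transform w = (1+z)/(1-z) moves the zeros into the unit disc and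
turns z_i + z_j into 1 - w_i w_j up to explicit factors. Expanding logarithms gives -log ∏|1 - w_i
w_j| = ∑_k (∑_i w_i^k)²/k ≥ 0, the power sums being real. Together these give 2^n ≤ p(1)²
(`two_pow_natDegree_le_eval_one_sq`), while p(1) is at most n+1 times the largest coefficient.

Upper bound. Powers of one polynomial P of degree 20 suffice. P is z^10 Q(z + 1/z) with Q stable by
a continued fraction (`stable_degree_ten`), and P(1) = 7167 < 1.56^20. If M bounds the coefficients
of P^a, then M·7167^b bounds those of P^(a+b) (`pMax_le_of_coeff_le`). The gap between 7167 and
1.56^20 beats the factor √N from a = 12 on; smaller powers are checked numerically. -/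

/-! ### Lower bound: power sums, Cayley transform, resultant -/

/-- A multiset stable under complex conjugation has real power sums, after any map commuting with
conjugation. -/
theorem im_sum_map_eq_zero {s : Multiset ℂ} (hs : s.map (starRingEnd ℂ) = s) {f : ℂ → ℂ}
    (hf : ∀ z, f (starRingEnd ℂ z) = starRingEnd ℂ (f z)) : (s.map f).sum.im = 0 := by
  rw [← Complex.conj_eq_iff_im, map_multiset_sum, Multiset.map_map]
  conv_rhs => rw [← hs, Multiset.map_map]
  simp only [Function.comp_def, hf]

theorem Multiset.exists_map_univ_eq {α : Type*} (s : Multiset α) {n : ℕ} (h : s.card = n) :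
    ∃ z : Fin n → α, Finset.univ.val.map z = s := by
  subst h
  induction s using Quotient.inductionOn with
  | h l =>
    refine ⟨fun i => l.get i, ?_⟩
    rw [Fin.univ_val_map]
    simp

theorem hasSum_neg_log_norm_one_sub {z : ℂ} (hz : ‖z‖ < 1) :
    HasSum (fun n : ℕ => (z ^ n / n).re) (-Real.log ‖1 - z‖) := by
  simpa [Complex.log_re] using Complex.hasSum_re (Complex.hasSum_taylorSeries_neg_log hz)

/-- For points of the open unit disc whose power sums are all real, `∏ |1 - wᵢ wⱼ| ≤ 1`. -/
theorem prod_norm_one_sub_mul_le_one {ι : Type*} [Fintype ι] {w : ι → ℂ} (hw : ∀ i, ‖w i‖ < 1)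
    (him : ∀ k : ℕ, (∑ i, w i ^ k).im = 0) : ∏ i, ∏ j, ‖1 - w i * w j‖ ≤ 1 := by
  have hlt : ∀ i j, ‖w i * w j‖ < 1 := fun i j => by
    rw [norm_mul]
    exact mul_lt_one_of_nonneg_of_lt_one_left (norm_nonneg _) (hw i) (hw j).le
  have hpos : ∀ i j, 0 < ‖1 - w i * w j‖ := fun i j => by
    rw [norm_pos_iff, sub_ne_zero]
    intro h
    have := hlt i j
    rw [← h] at this
    simp at this
  have hsum : HasSum (fun n : ℕ => ∑ i, ∑ j, ((w i * w j) ^ n / n).re)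
      (∑ i, ∑ j, -Real.log ‖1 - w i * w j‖) :=
    hasSum_sum fun i _ => hasSum_sum fun j _ => hasSum_neg_log_norm_one_sub (hlt i j)
  have hnn : 0 ≤ ∑ i, ∑ j, -Real.log ‖1 - w i * w j‖ := by
    refine hsum.nonneg fun n => ?_
    -- The double sum factors as the square of a power sum; that power sum is real, so each term of
    -- the series is nonnegative.
    have h : ∑ i, ∑ j, ((w i * w j) ^ n / n).re = ((∑ i, w i ^ n) ^ 2).re / n := by
      rw [sq, Finset.sum_mul_sum, Complex.re_sum, Finset.sum_div]
      refine Finset.sum_congr rfl fun i _ => ?_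
      rw [Complex.re_sum, Finset.sum_div]
      exact Finset.sum_congr rfl fun j _ => by rw [mul_pow, Complex.div_natCast_re]
    rw [h, sq, Complex.mul_re, him n]
    have := mul_self_nonneg (∑ i, w i ^ n).re
    simp only [mul_zero, sub_zero]
    positivity
  have hlog : Real.log (∏ i, ∏ j, ‖1 - w i * w j‖) ≤ 0 := by
    rw [Real.log_prod fun i _ => (Finset.prod_pos fun j _ => hpos i j).ne']
    simp only [Finset.sum_neg_distrib] at hnn
    refine le_trans (le_of_eq ?_) (neg_nonneg.1 hnn)
    exact Finset.sum_congr rfl fun i _ => Real.log_prod fun j _ => (hpos i j).ne'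
  exact (Real.log_nonpos_iff (by positivity)).1 hlog

/-- The Cayley transform maps the open left half-plane into the open unit disc. -/
theorem norm_cayley_lt_one {z : ℂ} (hz : z.re < 0) : ‖(1 + z) / (1 - z)‖ < 1 := by
  have h1 : 0 < ‖1 - z‖ := by
    rw [norm_pos_iff, sub_ne_zero]
    rintro rfl
    norm_num at hz
  rw [norm_div, div_lt_one h1, ← sq_lt_sq₀ (norm_nonneg _) h1.le, Complex.sq_norm, Complex.sq_norm,
    Complex.normSq_apply, Complex.normSq_apply]
  simp only [Complex.add_re, Complex.add_im, Complex.sub_re, Complex.sub_im, Complex.one_re,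
    Complex.one_im]
  nlinarith

/-- For points of the open left half-plane forming a conjugation-invariant family,
`2 ^ (n ^ 2) * ∏ |zᵢ + zⱼ| ≤ (∏ |1 - zᵢ|) ^ (2 * n)`. -/
theorem two_pow_mul_prod_norm_add_le {n : ℕ} {z : Fin n → ℂ} (hz : ∀ i, (z i).re < 0)
    (hconj : (Finset.univ.val.map z).map (starRingEnd ℂ) = Finset.univ.val.map z) :
    2 ^ (n * n) * ∏ i, ∏ j, ‖z i + z j‖ ≤ (∏ i, ‖1 - z i‖) ^ (2 * n) := by
  set w : Fin n → ℂ := fun i => (1 + z i) / (1 - z i) with hw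
  have hne : ∀ i, 1 - z i ≠ 0 := fun i => by
    rw [sub_ne_zero]
    intro h
    have := hz i
    rw [← h] at this
    norm_num at this
  have hle : ∏ i, ∏ j, ‖1 - w i * w j‖ ≤ 1 := by
    refine prod_norm_one_sub_mul_le_one (fun i => norm_cayley_lt_one (hz i)) fun k => ?_
    have := im_sum_map_eq_zero hconj (f := fun z => ((1 + z) / (1 - z)) ^ k) (by simp)
    rw [Multiset.map_map] at this
    exact this
  have key : ∀ i j, 2 * ‖z i + z j‖ = ‖1 - w i * w j‖ * (‖1 - z i‖ * ‖1 - z j‖) := fun i j => by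
    have h : 2 * (z i + z j) = -((1 - w i * w j) * ((1 - z i) * (1 - z j))) := by
      have := hne i
      have := hne j
      simp only [hw]
      field_simp
      ring
    have := congrArg norm h
    simpa [norm_mul] using this
  calc 2 ^ (n * n) * ∏ i, ∏ j, ‖z i + z j‖ = ∏ i, ∏ j, 2 * ‖z i + z j‖ := by
        simp [Finset.prod_mul_distrib, ← pow_mul]
    _ = (∏ i, ∏ j, ‖1 - w i * w j‖) * (∏ i, ‖1 - z i‖) ^ (2 * n) := by
        simp only [key, Finset.prod_mul_distrib]
        simp only [Finset.prod_const, Finset.card_univ, Fintype.card_fin, Finset.prod_pow]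
        ring
    _ ≤ 1 * (∏ i, ‖1 - z i‖) ^ (2 * n) := by gcongr
    _ = _ := one_mul _

/-- A Hurwitz stable polynomial with integer coefficients satisfies `2 ^ n ≤ p(1) ^ 2`. -/
theorem two_pow_natDegree_le_eval_one_sq {p : ℤ[X]} (hdeg : 0 < p.natDegree)
    (hp : IsHurwitzStable (p.map (Int.castRingHom ℝ))) :
    2 ^ p.natDegree ≤ (p.eval 1) ^ 2 := by
  set P : ℂ[X] := p.map (Int.castRingHom ℂ) with hP
  set a := P.leadingCoeff with ha
  have hinj : Function.Injective (Int.castRingHom ℂ) := Int.cast_injective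
  have hp0 : p ≠ 0 := by
    rintro rfl
    simp at hdeg
  have hP0 : P ≠ 0 := (Polynomial.map_ne_zero_iff hinj).2 hp0
  have hPdeg : P.natDegree = p.natDegree := natDegree_map_eq_of_injective hinj p
  have hsplit : P.Splits := IsAlgClosed.splits P
  have hre : ∀ z ∈ P.roots, z.re < 0 := fun z hz => by
    refine hp z ?_
    rw [mem_roots hP0, IsRoot.def] at hz
    rw [aeval_def, eval₂_map, ← hz, hP, eval_map]
    congr 1
  have hconj : P.roots.map (starRingEnd ℂ) = P.roots := by
    rw [← hsplit.roots_map, hP, Polynomial.map_map]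
    congr 2
    exact RingHom.ext_int _ _
  set n := p.natDegree
  obtain ⟨z, hzroots⟩ := Multiset.exists_map_univ_eq P.roots
    (hsplit.natDegree_eq_card_roots.symm.trans hPdeg)
  have hzre : ∀ i, (z i).re < 0 := fun i => hre _ (by rw [← hzroots]; simp)
  have heval : ∀ x, P.eval x = a * ∏ i, (x - z i) := fun x => by
    rw [hsplit.eval_eq_prod_roots, ← hzroots, Multiset.map_map]
    rfl
  have hres : ((p.resultant (p.comp (-X)) n n : ℤ) : ℂ)
      = a ^ (2 * n) * ∏ i, ∏ j, (-(z i + z j)) := by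
    have h1 := resultant_eq_prod_eval P (P.comp (-X)) n
      (by rw [natDegree_comp, natDegree_neg, natDegree_X, mul_one, hPdeg]) hsplit
    rw [hPdeg, show P.comp (-X) = (p.comp (-X)).map (Int.castRingHom ℂ) by simp [hP, Polynomial.map_comp],
      resultant_map_map] at h1
    rw [show ((p.resultant (p.comp (-X)) n n : ℤ) : ℂ)
      = Int.castRingHom ℂ (p.resultant (p.comp (-X)) n n) from rfl, h1, ← hzroots, Multiset.map_map]
    change _ * ∏ i, _ = _
    have h2 : ∀ i, (eval (z i) (map (Int.castRingHom ℂ) (p.comp (-X)))) =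
        a * ∏ j, (-(z i + z j)) := fun i => by
      rw [Polynomial.map_comp, eval_comp, ← hP, heval]
      simp only [Polynomial.map_neg, map_X, eval_neg, eval_X, neg_add']
    simp only [Function.comp_apply, h2, Finset.prod_mul_distrib, Finset.prod_const,
      Finset.card_univ, Fintype.card_fin]
    ring
  have ha0 : a ≠ 0 := leadingCoeff_ne_zero.2 hP0
  have hres1 : (1 : ℝ) ≤ ‖a‖ ^ (2 * n) * ∏ i, ∏ j, ‖z i + z j‖ := by
    -- A vanishing resultant would force z_i + z_j = 0, impossible for two points of the open left
    -- half-plane.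
    have h0 : p.resultant (p.comp (-X)) n n ≠ 0 := by
      intro h
      rw [h, Int.cast_zero, eq_comm, mul_eq_zero] at hres
      rcases hres with h | h
      · exact pow_ne_zero _ ha0 h
      · obtain ⟨i, -, hi⟩ := Finset.prod_eq_zero_iff.1 h
        obtain ⟨j, -, hj⟩ := Finset.prod_eq_zero_iff.1 hi
        have := congrArg Complex.re hj
        simp only [Complex.neg_re, Complex.add_re, Complex.zero_re] at this
        linarith [hzre i, hzre j]
    have h1 := congrArg norm hres
    simp only [norm_mul, norm_pow, norm_prod, norm_neg, Complex.norm_intCast] at h1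
    rw [← h1]
    exact_mod_cast Int.one_le_abs h0
  have hmain : ((2 : ℝ) ^ n) ^ n ≤ (((p.eval 1 : ℤ) : ℝ) ^ 2) ^ n := by
    have h1 := two_pow_mul_prod_norm_add_le hzre (by rw [hzroots, hconj])
    have h2 : ‖(((p.eval 1 : ℤ)) : ℂ)‖ = ‖a‖ * ∏ i, ‖1 - z i‖ := by
      rw [← norm_prod, ← norm_mul, ← heval, hP, ← Int.cast_one (R := ℂ), eval_intCast_map]
      simp
    rw [Complex.norm_intCast] at h2
    rw [← sq_abs, h2]
    calc ((2 : ℝ) ^ n) ^ n = 2 ^ (n * n) * 1 := by rw [pow_mul, mul_one]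
      _ ≤ 2 ^ (n * n) * (‖a‖ ^ (2 * n) * ∏ i, ∏ j, ‖z i + z j‖) := by gcongr
      _ = ‖a‖ ^ (2 * n) * (2 ^ (n * n) * ∏ i, ∏ j, ‖z i + z j‖) := by ring
      _ ≤ ‖a‖ ^ (2 * n) * (∏ i, ‖1 - z i‖) ^ (2 * n) := by gcongr
      _ = _ := by rw [← mul_pow, pow_mul]
  have := (pow_le_pow_iff_left₀ (by positivity) (by positivity) hdeg.ne').1 hmain
  exact_mod_cast this

theorem coeff_le_maxCoeff (p : ℤ[X]) {i : ℕ} (hi : i ≤ p.natDegree) : p.coeff i ≤ maxCoeff p :=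
  Finset.le_sup' p.coeff (Finset.mem_range.2 (Nat.lt_succ_of_le hi))

theorem eval_one_le_mul_maxCoeff (p : ℤ[X]) : p.eval 1 ≤ (p.natDegree + 1) * maxCoeff p := by
  rw [eval_eq_sum_range]
  simp only [one_pow, mul_one]
  refine (Finset.sum_le_card_nsmul _ _ (maxCoeff p) fun i hi =>
    coeff_le_maxCoeff p (Nat.lt_succ_iff.1 (Finset.mem_range.1 hi))).trans (le_of_eq ?_)
  simp

theorem lower_bound_pMax {N : ℕ} (hN : 20 ≤ N) : (1.41 : ℝ) ^ N / (N : ℝ) < (pMax N : ℝ) := by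
  obtain ⟨p, ⟨hdeg, hpos, hst⟩, hp⟩ := (isLeast_pMax N).1
  rw [← hp]
  have h1 := two_pow_natDegree_le_eval_one_sq (by omega) hst
  have h2 := eval_one_le_mul_maxCoeff p
  rw [hdeg] at h1 h2
  have hNpos : (0 : ℝ) < N := by exact_mod_cast (by omega : 0 < N)
  have hmax : (0 : ℝ) ≤ maxCoeff p := by
    exact_mod_cast (hpos 0 (Nat.zero_le N)).le.trans (coeff_le_maxCoeff p (Nat.zero_le _))
  have h1' : (2 : ℝ) ^ N ≤ ((p.eval 1 : ℤ) : ℝ) ^ 2 := by exact_mod_cast h1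
  have h2' : ((p.eval 1 : ℤ) : ℝ) ≤ (N + 1) * maxCoeff p := by exact_mod_cast h2
  have hev : (0 : ℝ) ≤ ((p.eval 1 : ℤ) : ℝ) := by
    rw [eval_eq_sum_range]
    exact_mod_cast Finset.sum_nonneg fun i hi => by
      simpa using (hpos i (by rw [← hdeg]; exact Nat.lt_succ_iff.1 (Finset.mem_range.1 hi))).le
  have h3 : (2 : ℝ) ^ N ≤ ((N + 1) * maxCoeff p) ^ 2 := h1'.trans (by gcongr)
  -- The slack between 1.41 and √2 absorbs (N+1)/N: 1.05² < (2/1.41²)^20.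
  have h4 : (1.41 ^ N * ((N + 1) / N)) ^ 2 < (2 : ℝ) ^ N := by
    have hb : ((N + 1 : ℝ) / N) ≤ 1.05 := by
      rw [div_le_iff₀ hNpos]
      have : (20 : ℝ) ≤ N := by exact_mod_cast hN
      linarith
    have hc : (1.05 : ℝ) ^ 2 < (2 / 1.41 ^ 2) ^ N :=
      lt_of_lt_of_le (by norm_num) (pow_le_pow_right₀ (by norm_num) hN : _ ≤ (2 / 1.41 ^ 2 : ℝ) ^ N)
    calc (1.41 ^ N * ((N + 1 : ℝ) / N)) ^ 2 ≤ (1.41 ^ N * 1.05) ^ 2 := by gcongr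
      _ = (1.41 ^ 2) ^ N * 1.05 ^ 2 := by rw [mul_pow, pow_right_comm]
      _ < (1.41 ^ 2) ^ N * (2 / 1.41 ^ 2) ^ N := by gcongr
      _ = 2 ^ N := by rw [← mul_pow]; norm_num
  have h5 := lt_of_pow_lt_pow_left₀ 2 (by positivity) (h4.trans_le h3)
  rw [div_lt_iff₀ hNpos]
  have h6 : (1.41 : ℝ) ^ N * ((N + 1) / N) = (N + 1) * (1.41 ^ N / N) := by ring
  rw [h6] at h5
  have := lt_of_mul_lt_mul_left h5 (by positivity)
  rwa [div_lt_iff₀ hNpos] at this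

/-! ### Stability of the degree ten polynomial -/

/-- One step of the continued fraction criterion: if `α f = β w g + γ h` with positive constants,
then on the closed right half-plane the condition `0 ≤ re (f * conj g)` together with
`(f, g) ≠ (0, 0)` follows from the same condition on `(g, h)`. -/
theorem continued_fraction_step {w f g h : ℂ} (hw : 0 ≤ w.re) {α β γ : ℝ} (hα : 0 < α)
    (hβ : 0 < β) (hγ : 0 < γ) (he : α * f = β * (w * g) + γ * h)
    (H : 0 ≤ g.re * h.re + g.im * h.im ∧ (g = 0 → h ≠ 0)) :
    0 ≤ f.re * g.re + f.im * g.im ∧ (f = 0 → g ≠ 0) := by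
  obtain ⟨H1, H2⟩ := H
  constructor
  · have hre := congrArg Complex.re he
    have him := congrArg Complex.im he
    simp only [Complex.add_re, Complex.add_im, Complex.mul_re, Complex.mul_im, Complex.ofReal_re,
      Complex.ofReal_im] at hre him
    -- Multiply the relation by the conjugate of g and take real parts.
    have h1 : α * (f.re * g.re + f.im * g.im) = β * (w.re * (g.re ^ 2 + g.im ^ 2)) +
        γ * (g.re * h.re + g.im * h.im) := by
      linear_combination g.re * hre + g.im * him
    have h2 : 0 ≤ α * (f.re * g.re + f.im * g.im) := by rw [h1]; positivity
    exact nonneg_of_mul_nonneg_right h2 hα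
  · rintro rfl rfl
    refine H2 rfl ?_
    simpa [hγ.ne'] using he

/-- A point `w` of the closed right half-plane is not a zero of
`w¹⁰ + w⁹ + 9w⁸ + 7w⁷ + 24w⁶ + 13w⁵ + 24w⁴ + 7w³ + 9w² + w + 1`. -/
theorem stable_degree_ten {w : ℂ} (hw : 0 ≤ w.re) :
    w ^ 10 + w ^ 9 + 9 * w ^ 8 + 7 * w ^ 7 + 24 * w ^ 6 + 13 * w ^ 5 + 24 * w ^ 4 + 7 * w ^ 3
      + 9 * w ^ 2 + w + 1 ≠ 0 := by
  -- The Euclidean algorithm on the even and odd parts of the polynomial, run backwards from the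
  -- pair (w, 1); the constants are its quotients and remainders with denominators cleared.
  have h0 : 0 ≤ (w : ℂ).re * (1 : ℂ).re + (w : ℂ).im * (1 : ℂ).im ∧ (w = 0 → (1 : ℂ) ≠ 0) := by
    simpa using hw
  have h1 := continued_fraction_step (f := 47 * w ^ 2 + 15) hw (α := 1) (β := 47) (γ := 15)
    (by norm_num) (by norm_num) (by norm_num) (by push_cast; ring) h0
  have h2 := continued_fraction_step (f := 5 * w ^ 3 + 2 * w) hw (α := 47) (β := 5) (γ := 19)
    (by norm_num) (by norm_num) (by norm_num) (by push_cast; ring) h1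
  have h3 := continued_fraction_step (f := 19 * w ^ 4 + 17 * w ^ 2 + 3) hw
    (α := 5) (β := 19) (γ := 1)
    (by norm_num) (by norm_num) (by norm_num) (by push_cast; ring) h2
  have h4 := continued_fraction_step (f := 3 * w ^ 5 + 4 * w ^ 3 + w) hw
    (α := 19) (β := 3) (γ := 5)
    (by norm_num) (by norm_num) (by norm_num) (by push_cast; ring) h3
  have h5 := continued_fraction_step (f := 15 * w ^ 6 + 39 * w ^ 4 + 22 * w ^ 2 + 3) hw
    (α := 1) (β := 5) (γ := 1)
    (by norm_num) (by norm_num) (by norm_num) (by push_cast; ring) h4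
  have h6 := continued_fraction_step (f := 3 * w ^ 7 + 9 * w ^ 5 + 6 * w ^ 3 + w) hw
    (α := 5) (β := 1) (γ := 2)
    (by norm_num) (by norm_num) (by norm_num) (by push_cast; ring) h5
  have h7 := continued_fraction_step
    (f := 2 * w ^ 8 + 11 * w ^ 6 + 17 * w ^ 4 + 8 * w ^ 2 + 1) hw (α := 3) (β := 2) (γ := 1)
    (by norm_num) (by norm_num) (by norm_num) (by push_cast; ring) h6
  have h8 := continued_fraction_step (f := w ^ 9 + 7 * w ^ 7 + 13 * w ^ 5 + 7 * w ^ 3 + w) hw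
    (α := 2) (β := 1) (γ := 1)
    (by norm_num) (by norm_num) (by norm_num) (by push_cast; ring) h7
  obtain ⟨h9, h10⟩ := continued_fraction_step
    (f := w ^ 10 + 9 * w ^ 8 + 24 * w ^ 6 + 24 * w ^ 4 + 9 * w ^ 2 + 1) hw
    (α := 1) (β := 1) (γ := 1)
    (by norm_num) (by norm_num) (by norm_num) (by push_cast; ring) h8
  clear h0 h1 h2 h3 h4 h5 h6 h7 h8
  intro h
  set e := w ^ 10 + 9 * w ^ 8 + 24 * w ^ 6 + 24 * w ^ 4 + 9 * w ^ 2 + 1 with he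
  set o := w ^ 9 + 7 * w ^ 7 + 13 * w ^ 5 + 7 * w ^ 3 + w with ho
  -- At a zero the even part is minus the odd part, so `h9` says -|o|² ≥ 0 and both parts vanish.
  have heo : e = -o := by rw [he, ho]; linear_combination h
  rw [heo] at h9 h10
  simp only [Complex.neg_re, Complex.neg_im] at h9
  have hr : o.re = 0 := by nlinarith [mul_self_nonneg o.re, mul_self_nonneg o.im]
  have hi : o.im = 0 := by nlinarith [mul_self_nonneg o.re, mul_self_nonneg o.im]
  have h0 : o = 0 := Complex.ext hr hi
  exact h10 (by rw [h0, neg_zero]) h0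

/-! ### Computing with coefficient lists -/

/-- The polynomial with the given list of coefficients, constant term first. -/
noncomputable def ofCoeffList : List ℕ → ℤ[X]
  | [] => 0
  | a :: l => C (a : ℤ) + X * ofCoeffList l

/-- Arithmetic on lists of natural numbers is evaluated by the kernel, so coefficient bounds for
explicit powers can be decided. -/
def addCoeffList : List ℕ → List ℕ → List ℕ
  | [], m => m
  | l, [] => l
  | a :: l, b :: m => (a + b) :: addCoeffList l m

def mulCoeffList : List ℕ → List ℕ → List ℕ
  | [], _ => []
  | a :: l, m => addCoeffList (m.map (a * ·)) (0 :: mulCoeffList l m)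

theorem ofCoeffList_add (l m : List ℕ) :
    ofCoeffList (addCoeffList l m) = ofCoeffList l + ofCoeffList m := by
  induction l generalizing m with
  | nil => simp [addCoeffList, ofCoeffList]
  | cons a l ih =>
    cases m with
    | nil => simp [addCoeffList, ofCoeffList]
    | cons b m =>
      simp only [addCoeffList, ofCoeffList, ih, Nat.cast_add, C_add]
      ring

theorem ofCoeffList_map_mul (a : ℕ) (m : List ℕ) :
    ofCoeffList (m.map (a * ·)) = C (a : ℤ) * ofCoeffList m := by
  induction m with
  | nil => simp [ofCoeffList]
  | cons b m ih =>
    simp only [List.map_cons, ofCoeffList, ih, Nat.cast_mul, C_mul]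
    ring

theorem ofCoeffList_mul (l m : List ℕ) :
    ofCoeffList (mulCoeffList l m) = ofCoeffList l * ofCoeffList m := by
  induction l with
  | nil => simp [mulCoeffList, ofCoeffList]
  | cons a l ih =>
    simp only [mulCoeffList, ofCoeffList_add, ofCoeffList_map_mul, ofCoeffList, ih]
    simp
    ring

theorem coeff_ofCoeffList (l : List ℕ) (i : ℕ) : (ofCoeffList l).coeff i = (l.getD i 0 : ℕ) := by
  induction l generalizing i with
  | nil => simp [ofCoeffList]
  | cons a l ih =>
    cases i with
    | zero => simp [ofCoeffList]
    | succ i => simp [ofCoeffList, ih, coeff_X_mul]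

theorem coeff_ofCoeffList_le {l : List ℕ} {M : ℕ} (h : ∀ a ∈ l, a ≤ M) (i : ℕ) :
    (ofCoeffList l).coeff i ≤ M := by
  rw [coeff_ofCoeffList, Nat.cast_le]
  rcases lt_or_ge i l.length with hi | hi
  · rw [List.getD_eq_getElem _ _ hi]
    exact h _ (List.getElem_mem hi)
  · rw [List.getD_eq_default _ _ hi]
    exact Nat.zero_le _

/-! ### The degree 20 polynomial and its powers -/

/-- The coefficients of `z ^ 10 * Q (z + 1 / z)`, where `Q` is the polynomial of
`stable_degree_ten`. -/
def extremalCoeffs : List ℕ :=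
  [1, 1, 19, 16, 141, 98, 540, 303, 1179, 523, 1525, 523, 1179, 303, 540, 98, 141, 16, 19, 1, 1]

/-- A Hurwitz stable polynomial of degree `20` with small positive integer coefficients. -/
noncomputable def extremalPoly : ℤ[X] := ofCoeffList extremalCoeffs

theorem coeff_extremalPoly_pos {i : ℕ} (hi : i ≤ 20) : 0 < extremalPoly.coeff i := by
  rw [extremalPoly, coeff_ofCoeffList]
  interval_cases i <;> simp [extremalCoeffs]

theorem natDegree_extremalPoly : extremalPoly.natDegree = 20 := by
  refine natDegree_eq_of_le_of_coeff_ne_zero ?_ (coeff_extremalPoly_pos le_rfl).ne'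
  rw [natDegree_le_iff_coeff_eq_zero]
  intro i hi
  rw [extremalPoly, coeff_ofCoeffList, List.getD_eq_default _ _ (by simp [extremalCoeffs]; omega)]
  rfl

theorem isHurwitzStable_extremalPoly :
    IsHurwitzStable (extremalPoly.map (Int.castRingHom ℝ)) := by
  intro z hz
  by_contra hre
  rw [not_lt] at hre
  simp only [extremalPoly, extremalCoeffs, ofCoeffList, Polynomial.map_add, Polynomial.map_mul,
    map_C, map_X, Polynomial.map_zero, map_add, map_mul, aeval_X, aeval_C, map_zero] at hz
  simp only [map_natCast] at hz
  push_cast at hz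
  have hz0 : z ≠ 0 := by
    rintro rfl
    simp at hz
  -- The map z ↦ z + 1/z keeps the closed right half-plane, minus the origin, inside the closed
  -- right half-plane.
  have hw : 0 ≤ (z + z⁻¹).re := by
    rw [Complex.add_re, Complex.inv_re]
    exact add_nonneg hre (div_nonneg hre (Complex.normSq_nonneg z))
  refine stable_degree_ten hw ?_
  refine (mul_eq_zero_iff_left (pow_ne_zero 10 hz0)).1 ?_
  rw [← hz]
  field_simp
  ring

theorem coeff_mul_pos {p q : ℤ[X]} {m n : ℕ} (hpd : p.natDegree ≤ m) (hqd : q.natDegree ≤ n)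
    (hp : ∀ i ≤ m, 0 < p.coeff i) (hq : ∀ i ≤ n, 0 < q.coeff i) {i : ℕ} (hi : i ≤ m + n) :
    0 < (p * q).coeff i := by
  have hp0 : ∀ i, 0 ≤ p.coeff i := fun i => by
    rcases le_or_gt i m with h | h
    · exact (hp i h).le
    · rw [coeff_eq_zero_of_natDegree_lt (hpd.trans_lt h)]
  have hq0 : ∀ i, 0 ≤ q.coeff i := fun i => by
    rcases le_or_gt i n with h | h
    · exact (hq i h).le
    · rw [coeff_eq_zero_of_natDegree_lt (hqd.trans_lt h)]
  rw [coeff_mul]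
  refine Finset.sum_pos' (fun x _ => mul_nonneg (hp0 _) (hq0 _)) ⟨(min i m, i - min i m), ?_, ?_⟩
  · exact Finset.HasAntidiagonal.mem_antidiagonal.2 (Nat.add_sub_cancel' (min_le_left _ _))
  · exact mul_pos (hp _ (min_le_right _ _)) (hq _ (by omega))

theorem extremalPoly_pow_mem (m : ℕ) : extremalPoly ^ m ∈ positiveHurwitz (20 * m) := by
  refine ⟨?_, ?_, ?_⟩
  · rw [natDegree_pow, natDegree_extremalPoly, mul_comm]
  · induction m with
    | zero =>
      intro i hi
      simp [Nat.le_zero.1 hi]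
    | succ m ih =>
      intro i hi
      rw [pow_succ]
      exact coeff_mul_pos (by rw [natDegree_pow, natDegree_extremalPoly, mul_comm])
        natDegree_extremalPoly.le ih (fun _ => coeff_extremalPoly_pos) (by omega)
  · intro z hz
    rw [Polynomial.map_pow, map_pow] at hz
    exact isHurwitzStable_extremalPoly z (eq_zero_of_pow_eq_zero hz)

/-! ### Upper bound: growth of the coefficients of powers -/

/-- In the convolution, bound every coefficient of p by M; what remains is a partial sum of the
coefficients of q. -/
theorem coeff_mul_le_mul_eval_one {p q : ℤ[X]} {M : ℤ} (hp : ∀ i, p.coeff i ≤ M) (hM : 0 ≤ M)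
    (hq : ∀ i, 0 ≤ q.coeff i) (i : ℕ) : (p * q).coeff i ≤ M * q.eval 1 := by
  have h1 : q.eval 1 = ∑ j ∈ Finset.range (max q.natDegree i + 1), q.coeff j := by
    rw [eval_eq_sum_range' (n := max q.natDegree i + 1) (by omega)]
    simp
  rw [mul_comm p q, coeff_mul, Finset.Nat.sum_antidiagonal_eq_sum_range_succ
    (fun a b => q.coeff a * p.coeff b), h1, Finset.mul_sum]
  calc ∑ k ∈ Finset.range (i + 1), q.coeff k * p.coeff (i - k)
      ≤ ∑ k ∈ Finset.range (i + 1), M * q.coeff k := Finset.sum_le_sum fun k _ => by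
        rw [mul_comm]
        exact mul_le_mul_of_nonneg_right (hp _) (hq k)
    _ ≤ _ := Finset.sum_le_sum_of_subset_of_nonneg
        (Finset.range_mono (by omega)) fun k _ _ => mul_nonneg hM (hq k)

theorem eval_one_extremalPoly : extremalPoly.eval 1 = 7167 := by
  simp [extremalPoly, extremalCoeffs, ofCoeffList]

theorem coeff_extremalPoly_nonneg (i : ℕ) : 0 ≤ extremalPoly.coeff i := by
  rw [extremalPoly, coeff_ofCoeffList]
  positivity

/-- A bound for the coefficients of a power propagates to all larger powers. -/
theorem pMax_le_of_coeff_le {a M : ℕ} (h : ∀ i, (extremalPoly ^ a).coeff i ≤ M) (b : ℕ) :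
    pMax (20 * (a + b)) ≤ M * 7167 ^ b := by
  have hc : ∀ i, (extremalPoly ^ (a + b)).coeff i ≤ M * 7167 ^ b := by
    induction b with
    | zero => simpa using h
    | succ b ih =>
      intro i
      rw [← add_assoc, pow_succ, pow_succ, ← mul_assoc, ← eval_one_extremalPoly]
      rw [← eval_one_extremalPoly] at ih
      exact coeff_mul_le_mul_eval_one ih (by rw [eval_one_extremalPoly]; positivity)
        coeff_extremalPoly_nonneg i
  refine ((isLeast_pMax _).2 ⟨_, extremalPoly_pow_mem (a + b), rfl⟩).trans ?_
  exact Finset.sup'_le _ _ fun i _ => hc i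

def powCoeffList (l : List ℕ) : ℕ → List ℕ
  | 0 => [1]
  | n + 1 => mulCoeffList l (powCoeffList l n)

theorem ofCoeffList_pow (l : List ℕ) (n : ℕ) :
    ofCoeffList (powCoeffList l n) = ofCoeffList l ^ n := by
  induction n with
  | zero => simp [powCoeffList, ofCoeffList]
  | succ n ih => rw [powCoeffList, ofCoeffList_mul, ih, pow_succ']

theorem coeff_extremalPoly_pow_le {a M : ℕ} (h : ∀ c ∈ powCoeffList extremalCoeffs a, c ≤ M)
    (i : ℕ) : (extremalPoly ^ a).coeff i ≤ M := by
  rw [extremalPoly, ← ofCoeffList_pow]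
  exact coeff_ofCoeffList_le h i

/-- The rational s overestimates √N, which reduces the bound to rational arithmetic. -/
theorem pMax_lt_of_coeff_le {a M : ℕ} (h : ∀ c ∈ powCoeffList extremalCoeffs a, c ≤ M) {b : ℕ}
    {s : ℝ} (hs : 0 < s) (hsq : 20 * ((a + b : ℕ) : ℝ) ≤ s ^ 2)
    (hM : (M * 7167 ^ b : ℝ) < 1.56 ^ (20 * (a + b)) * (0.68 / s + 0.97 ^ (20 * (a + b))))
    (hab : 0 < a + b) :
    (pMax (20 * (a + b)) : ℝ) < (1.56 : ℝ) ^ (20 * (a + b)) *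
      (0.68 / Real.sqrt ((20 * (a + b) : ℕ) : ℝ) + (0.97 : ℝ) ^ (20 * (a + b))) := by
  have h1 : (pMax (20 * (a + b)) : ℝ) ≤ M * 7167 ^ b := by
    exact_mod_cast pMax_le_of_coeff_le (coeff_extremalPoly_pow_le h) b
  have h0 : 0 < Real.sqrt ((20 * (a + b) : ℕ) : ℝ) := Real.sqrt_pos.2 (by exact_mod_cast (by omega))
  have h2 : Real.sqrt ((20 * (a + b) : ℕ) : ℝ) ≤ s := by
    rw [Real.sqrt_le_left hs.le]
    exact_mod_cast hsq
  refine h1.trans_lt (hM.trans_le ?_)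
  gcongr

/-- Squared to remove √N. The long constant bounds the coefficients of the twelfth power, and 7285
stands in for 1.56^20 from below. -/
theorem growth_estimate (b : ℕ) :
    ((779849251252987522099310462575530089426546461 : ℝ) * 7167 ^ b) ^ 2 * (20 * (12 + b : ℝ)) <
      (7285 ^ (12 + b) * 0.68) ^ 2 := by
  rcases lt_or_ge b 20 with hb | hb
  · interval_cases b <;> norm_num
  · induction b, hb using Nat.le_induction with
    | base => norm_num
    | succ b hb ih =>
      -- Raising b by one multiplies N by (13+b)/(12+b), which for b ≥ 20 is at most (7285/7167)².
      have hk : (7167 : ℝ) ^ 2 * (20 * (12 + (b + 1 : ℕ) : ℝ)) ≤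
          7285 ^ 2 * (20 * (12 + b : ℝ)) := by
        have : (20 : ℝ) ≤ b := by exact_mod_cast hb
        push_cast
        linarith
      calc ((779849251252987522099310462575530089426546461 : ℝ) * 7167 ^ (b + 1)) ^ 2 *
            (20 * (12 + (b + 1 : ℕ) : ℝ))
          = (779849251252987522099310462575530089426546461 * 7167 ^ b) ^ 2 *
            (7167 ^ 2 * (20 * (12 + (b + 1 : ℕ) : ℝ))) := by rw [pow_succ]; ring
        _ ≤ (779849251252987522099310462575530089426546461 * 7167 ^ b) ^ 2 *
            (7285 ^ 2 * (20 * (12 + b : ℝ))) := by gcongr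
        _ = 7285 ^ 2 *
            ((779849251252987522099310462575530089426546461 * 7167 ^ b) ^ 2 * (20 * (12 + b : ℝ))) := by ring
        _ < 7285 ^ 2 * (7285 ^ (12 + b) * 0.68) ^ 2 := by gcongr
        _ = (7285 ^ (12 + (b + 1)) * 0.68) ^ 2 := by ring

theorem upper_bound_pMax_of_twelve_le (b : ℕ) :
    (pMax (20 * (12 + b)) : ℝ) < (1.56 : ℝ) ^ (20 * (12 + b)) *
      (0.68 / Real.sqrt ((20 * (12 + b) : ℕ) : ℝ) + (0.97 : ℝ) ^ (20 * (12 + b))) := by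
  have h1 : (pMax (20 * (12 + b)) : ℝ) ≤ 779849251252987522099310462575530089426546461 * 7167 ^ b := by
    exact_mod_cast pMax_le_of_coeff_le (a := 12) (M := 779849251252987522099310462575530089426546461)
      (coeff_extremalPoly_pow_le (by decide +kernel)) b
  have hs : 0 < Real.sqrt ((20 * (12 + b) : ℕ) : ℝ) := Real.sqrt_pos.2 (by positivity)
  have h2 : (779849251252987522099310462575530089426546461 : ℝ) * 7167 ^ b * Real.sqrt ((20 * (12 + b) : ℕ) : ℝ) <
      1.56 ^ (20 * (12 + b)) * 0.68 := by
    have h3 : (7285 : ℝ) ^ (12 + b) ≤ 1.56 ^ (20 * (12 + b)) := by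
      rw [pow_mul]
      gcongr
      norm_num
    refine lt_of_lt_of_le (lt_of_pow_lt_pow_left₀ 2 (by positivity) ?_)
      (mul_le_mul_of_nonneg_right h3 (by norm_num))
    rw [mul_pow, Real.sq_sqrt (by positivity)]
    push_cast
    exact growth_estimate b
  refine h1.trans_lt (((lt_div_iff₀ hs).2 h2).trans_le ?_)
  -- From the twelfth power on, the term 0.97^N is not needed and is dropped.
  rw [mul_div_assoc]
  gcongr
  simp only [le_add_iff_nonneg_right]
  positivity

theorem upper_bound_pMax {m : ℕ} (hm : 0 < m) :
    (pMax (20 * m) : ℝ) < (1.56 : ℝ) ^ (20 * m) *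
      (0.68 / Real.sqrt ((20 * m : ℕ) : ℝ) + (0.97 : ℝ) ^ (20 * m)) := by
  rcases lt_or_ge m 12 with h | h
  -- Here the term 0.97^N is kept. Each case starts from a computed power a and pays a factor 7167
  -- for each of the b remaining ones.
  · interval_cases m
    · exact pMax_lt_of_coeff_le (a := 1) (b := 0) (M := 1525) (s := 45 / 10)
        (by decide +kernel) (by norm_num) (by norm_num) (by norm_num) (by norm_num)
    · exact pMax_lt_of_coeff_le (a := 2) (b := 0) (M := 6479791) (s := 64 / 10)
        (by decide +kernel) (by norm_num) (by norm_num) (by norm_num) (by norm_num)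
    · exact pMax_lt_of_coeff_le (a := 2) (b := 1) (M := 6479791) (s := 78 / 10)
        (by decide +kernel) (by norm_num) (by norm_num) (by norm_num) (by norm_num)
    · exact pMax_lt_of_coeff_le (a := 2) (b := 2) (M := 6479791) (s := 90 / 10)
        (by decide +kernel) (by norm_num) (by norm_num) (by norm_num) (by norm_num)
    · exact pMax_lt_of_coeff_le (a := 4) (b := 1) (M := 203165388154471) (s := 101 / 10)
        (by decide +kernel) (by norm_num) (by norm_num) (by norm_num) (by norm_num)
    · exact pMax_lt_of_coeff_le (a := 4) (b := 2) (M := 203165388154471) (s := 110 / 10)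
        (by decide +kernel) (by norm_num) (by norm_num) (by norm_num) (by norm_num)
    · exact pMax_lt_of_coeff_le (a := 4) (b := 3) (M := 203165388154471) (s := 119 / 10)
        (by decide +kernel) (by norm_num) (by norm_num) (by norm_num) (by norm_num)
    · exact pMax_lt_of_coeff_le (a := 6) (b := 2) (M := 8218414301231659790221) (s := 127 / 10)
        (by decide +kernel) (by norm_num) (by norm_num) (by norm_num) (by norm_num)
    · exact pMax_lt_of_coeff_le (a := 6) (b := 3) (M := 8218414301231659790221) (s := 135 / 10)
        (by decide +kernel) (by norm_num) (by norm_num) (by norm_num) (by norm_num)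
    · exact pMax_lt_of_coeff_le (a := 8) (b := 2) (M := 362663002321931580943420991447) (s := 142 / 10)
        (by decide +kernel) (by norm_num) (by norm_num) (by norm_num) (by norm_num)
    · exact pMax_lt_of_coeff_le (a := 8) (b := 3) (M := 362663002321931580943420991447) (s := 149 / 10)
        (by decide +kernel) (by norm_num) (by norm_num) (by norm_num) (by norm_num)
  · obtain ⟨b, rfl⟩ := Nat.exists_eq_add_of_le h
    exact upper_bound_pMax_of_twelve_le b

theorem mainTheorem5 (N : ℕ) (hN : 0 < N) (h20 : 20 ∣ N) :
    (1.41 : ℝ) ^ N / (N : ℝ) < (pMax N : ℝ) ∧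
      (pMax N : ℝ) < (1.56 : ℝ) ^ N * (0.68 / Real.sqrt (N : ℝ) + (0.97 : ℝ) ^ N) := by
  refine ⟨lower_bound_pMax (Nat.le_of_dvd hN h20), ?_⟩
  obtain ⟨m, rfl⟩ := h20
  exact upper_bound_pMax (by omega)
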